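/- Let $\Sigma$ be the linear system $\dot x(t)=Ax(t)+Bu(t)$, $x(0)=x_0$, $y(t)=Cx(t)+Du(t)$ with $u(t)\in\mathbb R^m$, $x(t)\in\mathbb R^n$, $y(t)\in\mathbb R^p$ and real matrices $A,B,C,D$. Let $\mathcal U\subseteq\mathbb R^m$ and $\mathcal X\subseteq\mathbb R^n$ be arbitrary sets, and let $\mathfrak S$ denote the system $\Sigma$ subject to the constraints $u(t)\in\mathcal U$ and $x(t)\in\mathcal X$ for all $t\ge 0$. Inputs are causal, piecewise continuous (with finite one-sided limits) and exponentially bounded; states are continuous and outputs piecewise continuous on $[0,\infty)$; two signals are regarded as equal if they agree at almost every time $t\ge 0$. A pair $(x_0,y)$, with $x_0\in\mathcal X$ and $y$ a piecewise continuous output signal, is admissible if some input $u$ with $u(t)\in\mathcal U$ for all $t\ge0$ produces the output $y$ from the initial state $x_0$ along a state trajectory with $x(t)\in\mathcal X$ for all $t\ge 0$; it is input redundant if at least two distinct such inputs exist. Let $\mathbf A$ and $\mathbf S\subseteq\mathbf A$ be the sets of admissible and of input redundant pairs of $\mathfrak S$. The system $\mathfrak S$ is input redundant if $\mathbf S\neq\varnothing$,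 and uniformly input redundant if $\mathbf A=\mathbf S\neq\varnothing$; input redundancy of $\Sigma$ is the same notion with $\mathcal U=\mathbb R^m$ and $\mathcal X=\mathbb R^n$. Put $\rho=\dim(\ker B\cap\ker D)$. Assume that the unconstrained system $\Sigma$ is input redundant and that one of the following holds: - $\rho>0$ and $\mathcal U$ is open; - $\rho=0$ and both $\mathcal U$ and $\mathcal X$ are open. Then every admissible pair of $\mathfrak S$ is input redundant, i.e. $\mathbf S=\mathbf A$. Consequently, if $\mathfrak S$ has at least one admissible pair, then $\mathfrak S$ is uniformly input redundant, i.e. $\mathbf S=\mathbf A\neq\varnothing$. -/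

import Mathlib

open MeasureTheory Set Filter Topology
open scoped Matrix

namespace InputRedundancy

/- Vectors of `ℝ^k` are functions `Fin k → ℝ`; only their topology matters (the norm is used in
exponential bounds only, where all norms are equivalent). A signal on `ℝ≥0` is represented by a
function on `ℝ` of which only the values at times `t ≥ 0` are ever used. -/

/-- The matrices of the linear system `x' = A x + B u`, `y = C x + D u`. -/
structure LTISystem (n m p : ℕ) where
  A : Matrix (Fin n) (Fin n) ℝ
  B : Matrix (Fin n) (Fin m) ℝ
  C : Matrix (Fin p) (Fin n) ℝ
  D : Matrix (Fin p) (Fin m) ℝ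

/-- Equality of signals on `ℝ≥0`: they agree at almost every time. -/
def SignalEq {k : ℕ} (f g : ℝ → Fin k → ℝ) : Prop :=
  ∀ᵐ t ∂(volume.restrict (Ici (0 : ℝ))), f t = g t

/-- Piecewise continuity on `[0, ∞)`: finitely many discontinuities on each `[0, T]`, and finite
one-sided limits everywhere. -/
def IsPiecewiseContinuous {k : ℕ} (f : ℝ → Fin k → ℝ) : Prop :=
  (∀ T : ℝ, {t : ℝ | t ∈ Icc 0 T ∧ ¬ ContinuousWithinAt f (Ici 0) t}.Finite) ∧
  (∀ t : ℝ, 0 ≤ t → ∃ l : Fin k → ℝ, Tendsto f (𝓝[>] t) (𝓝 l)) ∧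
  (∀ t : ℝ, 0 < t → ∃ l : Fin k → ℝ, Tendsto f (𝓝[<] t) (𝓝 l))

/-- Unconstrained inputs: causal, piecewise continuous, exponentially bounded signals. -/
def InputSignals (m : ℕ) : Set (ℝ → Fin m → ℝ) :=
  {u | (∀ t : ℝ, t < 0 → u t = 0) ∧ IsPiecewiseContinuous u ∧
    ∃ M a : ℝ, ∀ t : ℝ, 0 ≤ t → ‖u t‖ ≤ M * Real.exp (a * t)}

/-- Unconstrained state trajectories: continuous functions on `[0, ∞)`. -/
def StateSignals (n : ℕ) : Set (ℝ → Fin n → ℝ) :=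
  {x | ContinuousOn x (Ici 0)}

/-- Outputs: piecewise continuous functions on `[0, ∞)`. -/
def OutputSignals (p : ℕ) : Set (ℝ → Fin p → ℝ) :=
  {y | IsPiecewiseContinuous y}

/-- Inputs complying with the input constraint set `U`. -/
def ConstrainedInputs {m : ℕ} (U : Set (Fin m → ℝ)) : Set (ℝ → Fin m → ℝ) :=
  {u | ∀ t : ℝ, 0 ≤ t → u t ∈ U} ∩ InputSignals m

/-- State trajectories complying with the state constraint set `X`. -/
def ConstrainedStates {n : ℕ} (X : Set (Fin n → ℝ)) : Set (ℝ → Fin n → ℝ) :=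
  {x | ∀ t : ℝ, 0 ≤ t → x t ∈ X} ∩ StateSignals n

namespace LTISystem

variable {n m p : ℕ}

/-- `ρ = dim (ker B ∩ ker D)`. -/
noncomputable def rho (S : LTISystem n m p) : ℕ :=
  Module.finrank ℝ
    (LinearMap.ker S.B.mulVecLin ⊓ LinearMap.ker S.D.mulVecLin : Submodule ℝ (Fin m → ℝ))

/-- `x` is the state trajectory produced by the input `u` from `x0`: it solves `x' = A x + B u`,
`x 0 = x0`, in integral form (as `u` is only piecewise continuous). -/
def IsStateResponse (S : LTISystem n m p) (x0 : Fin n → ℝ)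
    (u : ℝ → Fin m → ℝ) (x : ℝ → Fin n → ℝ) : Prop :=
  ∀ t : ℝ, 0 ≤ t → x t = x0 + ∫ s in (0 : ℝ)..t, (S.A *ᵥ x s + S.B *ᵥ u s)

/-- Input-state-output triples of the unconstrained system compatible for `x0`. -/
def unconstrainedTriples (S : LTISystem n m p) (x0 : Fin n → ℝ) :
    Set ((ℝ → Fin m → ℝ) × (ℝ → Fin n → ℝ) × (ℝ → Fin p → ℝ)) :=
  {q | q ∈ InputSignals m ×ˢ StateSignals n ×ˢ OutputSignals p ∧
    S.IsStateResponse x0 q.1 q.2.1 ∧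
    SignalEq q.2.2 (fun t => S.C *ᵥ q.2.1 t + S.D *ᵥ q.1 t)}

/-- Input-state-output triples of the constrained system compatible for `x0`. -/
def triples (S : LTISystem n m p) (U : Set (Fin m → ℝ)) (X : Set (Fin n → ℝ))
    (x0 : Fin n → ℝ) : Set ((ℝ → Fin m → ℝ) × (ℝ → Fin n → ℝ) × (ℝ → Fin p → ℝ)) :=
  S.unconstrainedTriples x0 ∩ (ConstrainedInputs U ×ˢ ConstrainedStates X ×ˢ OutputSignals p)

/-- Input-output pairs of the constrained system compatible for `x0`. -/
def ioPairs (S : LTISystem n m p) (U : Set (Fin m → ℝ)) (X : Set (Fin n → ℝ))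
    (x0 : Fin n → ℝ) : Set ((ℝ → Fin m → ℝ) × (ℝ → Fin p → ℝ)) :=
  {w | ∃ x : ℝ → Fin n → ℝ, (w.1, x, w.2) ∈ S.triples U X x0}

/-- Admissible pairs `(x0, y)` of the constrained system. -/
def admissiblePairs (S : LTISystem n m p) (U : Set (Fin m → ℝ)) (X : Set (Fin n → ℝ)) :
    Set ((Fin n → ℝ) × (ℝ → Fin p → ℝ)) :=
  {a | a ∈ X ×ˢ OutputSignals p ∧ ∃ u : ℝ → Fin m → ℝ, (u, a.2) ∈ S.ioPairs U X a.1}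

/-- Input redundant pairs `(x0, y)` of the constrained system: two distinct inputs produce `y`
from `x0`. -/
def irPairs (S : LTISystem n m p) (U : Set (Fin m → ℝ)) (X : Set (Fin n → ℝ)) :
    Set ((Fin n → ℝ) × (ℝ → Fin p → ℝ)) :=
  {a | a ∈ X ×ˢ OutputSignals p ∧
    ∃ w₁ ∈ S.ioPairs U X a.1, ∃ w₂ ∈ S.ioPairs U X a.1,
      ¬ SignalEq w₁.1 w₂.1 ∧ SignalEq w₁.2 a.2 ∧ SignalEq w₂.2 a.2}

/-- The constrained system is input redundant. -/
def IsIR (S : LTISystem n m p) (U : Set (Fin m → ℝ)) (X : Set (Fin n → ℝ)) : Prop :=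
  (S.irPairs U X).Nonempty

/-- The unconstrained system is input redundant. -/
def IsUnconstrainedIR (S : LTISystem n m p) : Prop :=
  S.IsIR univ univ

/-- The constrained system is uniformly input redundant: it is input redundant and every
admissible pair is input redundant. -/
def IsUniformlyIR (S : LTISystem n m p) (U : Set (Fin m → ℝ)) (X : Set (Fin n → ℝ)) : Prop :=
  S.IsIR U X ∧ S.admissiblePairs U X = S.irPairs U X

end LTISystem

end InputRedundancy

/-!
The difference of two inputs witnessing redundancy of `Σ` is a nonzero input that, starting from the
state `0`, produces the output `0`. Let the polynomial ring `ℝ[X]` act on continuous causal signals,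
`X` being integration from time `0`; the primitives of the difference signals then satisfy the
linear relations encoded by a polynomial matrix, the system pencil. By uniqueness of solutions of
linear differential equations this module is torsion-free, so, `ℝ[X]` being a principal ideal
domain, the pencil kills a polynomial vector `(P, Q)` with `Q ≠ 0`. If `ker B ∩ ker D ≠ 0`, a
constant vector with `P = 0` does it.

Write a bump function as a high iterated integral of a signal `f` all of whose lower iterated
integrals vanish outside the same interval. Then the input `Q f` and the state `P f` vanish outside
that interval, start from the state `0` and produce the output `0`. Choosing the interval where a
given admissible input is continuous, a compactness argument shows that adding a small multiple
respects the open constraints; it does not move the state at all when `P = 0`.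
-/

namespace InputRedundancy

open Polynomial

section Causal

lemma integral_eq_zero_of_causal {E : Type*} [NormedAddCommGroup E] [NormedSpace ℝ E]
    {f : ℝ → E} (hf : ∀ t < 0, f t = 0) {t : ℝ} (ht : t ≤ 0) : ∫ s in (0 : ℝ)..t, f s = 0 := by
  refine intervalIntegral.integral_zero_ae ?_
  filter_upwards [Measure.ae_ne volume (0 : ℝ)] with s hs hst
  rw [uIoc_of_ge ht] at hst
  exact hf s (hst.2.lt_of_ne hs)

lemma intervalIntegrable_of_locallyIntegrable {E : Type*} [NormedAddCommGroup E] {f : ℝ → E}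
    (hf : LocallyIntegrable f) (a b : ℝ) : IntervalIntegrable f volume a b :=
  (intervalIntegrable_iff').2 (hf.integrableOn_isCompact isCompact_uIcc)

lemma ae_eq_zero_of_primitive_eq_zero {E : Type*} [NormedAddCommGroup E] [NormedSpace ℝ E]
    [CompleteSpace E] {f : ℝ → E} (hf : LocallyIntegrable f)
    (h : ∀ t, ∫ s in (0 : ℝ)..t, f s = 0) : f =ᵐ[volume] 0 := by
  filter_upwards [LocallyIntegrable.ae_hasDerivAt_integral hf] with t ht
  refine (ht 0).unique ?_
  simp only [h]
  exact hasDerivAt_const t 0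

/-- The space of continuous real signals that vanish at all times `t ≤ 0`. -/
def causalFunctions : Submodule ℝ (ℝ → ℝ) where
  carrier := {f | Continuous f ∧ ∀ t ≤ 0, f t = 0}
  add_mem' hf hg := ⟨hf.1.add hg.1, fun t ht => by simp [hf.2 t ht, hg.2 t ht]⟩
  zero_mem' := ⟨continuous_const, fun _ _ => rfl⟩
  smul_mem' c _ hf := ⟨hf.1.const_smul c, fun t ht => by simp [hf.2 t ht]⟩

lemma causalFunctions_ext {f g : causalFunctions} (h : ∀ t, 0 ≤ t → f.1 t = g.1 t) : f = g := by
  ext t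
  rcases le_total 0 t with ht | ht
  · exact h t ht
  · rw [f.2.2 t ht, g.2.2 t ht]

/-- The primitive, from time `0`, of a locally integrable signal that vanishes at negative times. -/
noncomputable def primitive (f : ℝ → ℝ) (hf : LocallyIntegrable f) (hf0 : ∀ t < 0, f t = 0) :
    causalFunctions :=
  ⟨fun t => ∫ s in (0 : ℝ)..t, f s,
    intervalIntegral.continuous_primitive (intervalIntegrable_of_locallyIntegrable hf) 0,
    fun _ => integral_eq_zero_of_causal hf0⟩

/-- Integration from time `0`, as an operator on causal signals. -/
noncomputable def integration : Module.End ℝ causalFunctions where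
  toFun f := primitive f.1 f.2.1.locallyIntegrable fun t ht => f.2.2 t ht.le
  map_add' f g := by
    ext t
    exact intervalIntegral.integral_add (f.2.1.intervalIntegrable 0 t)
      (g.2.1.intervalIntegrable 0 t)
  map_smul' c f := by
    ext t
    exact intervalIntegral.integral_const_mul c f.1

lemma integration_apply (f : causalFunctions) (t : ℝ) :
    (integration f).1 t = ∫ s in (0 : ℝ)..t, f.1 s := rfl

lemma hasDerivAt_integration (f : causalFunctions) (t : ℝ) :
    HasDerivAt (integration f).1 (f.1 t) t :=
  (f.2.1.integral_hasStrictDerivAt 0 t).hasDerivAt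

lemma integration_injective : Function.Injective integration := by
  intro f g hfg
  ext t
  exact (hfg ▸ hasDerivAt_integration f t).unique (hasDerivAt_integration g t)

/- Integration restricts to a bijection of `V`, so `V` consists of solutions of a linear
differential equation with initial value `0`. -/
lemma eq_bot_of_le_comap_integration (V : Submodule ℝ causalFunctions) [FiniteDimensional ℝ V]
    (hV : V ≤ V.comap integration) : V = ⊥ := by
  have hinj : Function.Injective (integration.restrict hV) := fun f g h =>
    Subtype.ext (integration_injective (congrArg Subtype.val h))
  let J : V ≃ₗ[ℝ] V := LinearEquiv.ofInjectiveEndo (V := V) (K := ℝ) (integration.restrict hV) hinj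
  have : Module.Free ℝ V := Module.Free.of_divisionRing ℝ V
  let b := Module.finBasis ℝ V
  let F : ℝ → Fin (Module.finrank ℝ V) → ℝ := fun t i => (b i).1.1 t
  let L := (LinearMap.toMatrix b b J.symm.toLinearMap)ᵀ.mulVecLin.toContinuousLinearMap
  have hF (t : ℝ) : HasDerivAt F (L (F t)) t := by
    refine hasDerivAt_pi.2 fun i => ?_
    have hderiv : HasDerivAt (b i).1.1 ((J.symm (b i)).1.1 t) t := by
      have hJ : integration (J.symm (b i)).1 = (b i).1 :=
        congrArg Subtype.val (J.apply_symm_apply (b i))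
      exact hJ ▸ hasDerivAt_integration (J.symm (b i)).1 t
    have hL : L (F t) i = (J.symm (b i)).1.1 t := by
      have hsum := congrArg (fun f : V => f.1.1 t) (b.sum_repr (J.symm (b i)))
      simp only [Submodule.coe_sum, Submodule.coe_smul, Finset.sum_apply, Pi.smul_apply,
        smul_eq_mul] at hsum
      simpa [L, F, Matrix.vecMul, dotProduct, LinearMap.toMatrix_apply, mul_comm] using hsum
    rwa [hL]
  have hF0 : F = 0 := by
    refine ODE_solution_unique_univ (v := fun _ => L) (s := fun _ => univ) (t₀ := 0)
      (fun _ => L.lipschitz.lipschitzOnWith) (fun t => ⟨hF t, mem_univ _⟩)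
      (fun t => ⟨?_, mem_univ _⟩) ?_
    · simp
    · exact funext fun i => (b i).1.2.2 0 le_rfl
  have : IsEmpty (Fin (Module.finrank ℝ V)) :=
    ⟨fun i => b.ne_zero i (Subtype.ext (Subtype.ext (funext fun t => congrFun (congrFun hF0 t) i)))⟩
  have : Subsingleton V := b.repr.toEquiv.subsingleton
  exact V.eq_bot_of_subsingleton

/-- Real polynomials act on causal signals, `X` acting as integration from time `0`. -/
noncomputable instance : Module ℝ[X] causalFunctions :=
  Module.compHom causalFunctions (aeval integration).toRingHom

lemma X_smul_eq_integration (f : causalFunctions) : (X : ℝ[X]) • f = integration f :=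
  DFunLike.congr_fun (aeval_X integration) f

lemma C_smul_eq_smul (c : ℝ) (f : causalFunctions) : (C c : ℝ[X]) • f = c • f :=
  DFunLike.congr_fun (aeval_C integration c) f

instance : IsScalarTower ℝ ℝ[X] causalFunctions where
  smul_assoc c q f := by rw [Polynomial.smul_eq_C_mul, mul_smul, C_smul_eq_smul]

instance : Module.IsTorsionFree ℝ[X] causalFunctions := by
  refine Module.isTorsionFree_iff_smul_eq_zero.2 fun q f h => or_iff_not_imp_left.2 fun hq => ?_
  let φ : (ℝ[X] ⧸ Ideal.span {q}) →ₗ[ℝ[X]] causalFunctions :=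
    Submodule.liftQ _ (LinearMap.toSpanSingleton ℝ[X] _ f)
      ((Submodule.span_singleton_le_iff_mem _ _).2 h)
  have : FiniteDimensional ℝ (ℝ[X] ⧸ Ideal.span {q}) := (AdjoinRoot.powerBasis hq).finite
  have hφ : LinearMap.range (φ.restrictScalars ℝ) = ⊥ := by
    refine eq_bot_of_le_comap_integration _ ?_
    rintro _ ⟨r, rfl⟩
    exact ⟨(X : ℝ[X]) • r, (map_smul φ X r).trans (X_smul_eq_integration _)⟩
  calc f = φ (Submodule.Quotient.mk 1) := (one_smul ℝ[X] f).symm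
    _ = 0 := LinearMap.congr_fun (LinearMap.range_eq_bot.1 hφ) _

end Causal

/- The span of the `v i` is finite and torsion-free, hence free, so linear functionals detect
`v i ≠ 0`. -/
lemma exists_mulVec_eq_zero_of_sum_smul_eq_zero {R M ι κ : Type*} [CommRing R] [IsDomain R]
    [IsPrincipalIdealRing R] [AddCommGroup M] [Module R M] [Module.IsTorsionFree R M] [Fintype ι]
    {A : Matrix κ ι R} {v : ι → M} (hv : ∀ k, ∑ i, A k i • v i = 0) {i : ι} (hi : v i ≠ 0) :
    ∃ x : ι → R, x i ≠ 0 ∧ A *ᵥ x = 0 := by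
  let w (i : ι) : Submodule.span R (range v) := ⟨v i, Submodule.subset_span (mem_range_self i)⟩
  have : Module.Finite R (Submodule.span R (range v)) :=
    Module.Finite.span_of_finite R (finite_range v)
  obtain ⟨l, hl⟩ : ∃ l : Module.Dual R (Submodule.span R (range v)), l (w i) ≠ 0 := by
    by_contra! h
    exact hi (congrArg Subtype.val ((Module.forall_dual_apply_eq_zero_iff R (w i)).1 h))
  refine ⟨fun i => l (w i), hl, funext fun k => ?_⟩
  have hw : ∑ i, A k i • w i = 0 := Subtype.ext (by simpa [w] using hv k)
  simpa [Matrix.mulVec, dotProduct] using congrArg l hw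

section Support

lemma exists_X_pow_smul_eq {φ : ℝ → ℝ} (hφ : ContDiff ℝ (⊤ : ℕ∞) φ) {a b : ℝ} (ha : 0 < a)
    (hs : tsupport φ ⊆ Icc a b) (L : ℕ) :
    ∃ f : causalFunctions, ((X ^ L : ℝ[X]) • f).1 = φ ∧
      ∀ k ≤ L, ∀ t ∉ Icc a b, ((X ^ k : ℝ[X]) • f).1 t = 0 := by
  have hzero {ψ : ℝ → ℝ} (hψ : tsupport ψ ⊆ Icc a b) {t : ℝ} (ht : t ∉ Icc a b) : ψ t = 0 :=
    image_eq_zero_of_notMem_tsupport fun h => ht (hψ h)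
  have hneg {t : ℝ} (ht : t ≤ 0) : t ∉ Icc a b := fun h => (ha.trans_le h.1).not_ge ht
  induction L generalizing φ with
  | zero => exact ⟨⟨φ, hφ.continuous, fun t ht => hzero hs (hneg ht)⟩, by simp,
      by simpa using fun t ht => hzero hs ht⟩
  | succ L ih =>
    have hderiv : ContDiff ℝ (⊤ : ℕ∞) (deriv φ) := (contDiff_infty_iff_deriv.1 hφ).2
    obtain ⟨f, hf, hfs⟩ := ih hderiv (tsupport_deriv_subset.trans hs)
    have hint : ((X ^ (L + 1) : ℝ[X]) • f).1 = φ := by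
      funext t
      rw [pow_succ', mul_smul, X_smul_eq_integration, integration_apply, hf,
        intervalIntegral.integral_deriv_eq_sub (fun _ _ => hφ.differentiable (by simp) _)
          (hderiv.continuous.intervalIntegrable 0 t), hzero hs (hneg le_rfl), sub_zero]
    refine ⟨f, hint, fun k hk t ht => ?_⟩
    rcases hk.lt_or_eq with hk | rfl
    · exact hfs k (Nat.le_of_lt_succ hk) t ht
    · exact hint ▸ hzero hs ht

lemma exists_smul_eq_zero_of_notMem_Icc {ι : Type*} [Finite ι] (q : ι → ℝ[X]) {a b : ℝ}
    (ha : 0 < a) (hab : a < b) :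
    ∃ f : causalFunctions, f ≠ 0 ∧ ∀ i, ∀ t ∉ Icc a b, (q i • f).1 t = 0 := by
  have := Fintype.ofFinite ι
  obtain ⟨φ, hφs, -, hφ, -, hφ1⟩ :=
    exists_contDiff_tsupport_subset (n := ⊤) (Icc_mem_nhds (left_lt_add_div_two.2 hab)
      (add_div_two_lt_right.2 hab))
  obtain ⟨f, hf, hfs⟩ := exists_X_pow_smul_eq hφ ha hφs (Finset.univ.sup fun i => (q i).natDegree)
  refine ⟨f, ?_, fun i t ht => ?_⟩
  · rintro rfl
    rw [smul_zero] at hf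
    simpa [hφ1] using congrFun hf ((a + b) / 2)
  · have hdeg : (q i).natDegree ≤ Finset.univ.sup fun i => (q i).natDegree :=
      Finset.le_sup (f := fun i => (q i).natDegree) (Finset.mem_univ i)
    rw [(q i).as_sum_range_C_mul_X_pow, Finset.sum_smul, Submodule.coe_sum, Finset.sum_apply]
    refine Finset.sum_eq_zero fun k hk => ?_
    rw [mul_smul, C_smul_eq_smul, Submodule.coe_smul, Pi.smul_apply, hfs k (by grind) t ht,
      smul_zero]

end Support

section Signals

variable {k : ℕ} {u v : ℝ → Fin k → ℝ} {a b : ℝ}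

lemma SignalEq.symm (h : SignalEq u v) : SignalEq v u :=
  EventuallyEq.symm h

lemma SignalEq.trans {w : ℝ → Fin k → ℝ} (huv : SignalEq u v) (hvw : SignalEq v w) :
    SignalEq u w :=
  EventuallyEq.trans huv hvw

lemma eq_zero_of_signalEq_zero (hv : Continuous v) (ha : 0 < a) (hs : ∀ t ∉ Icc a b, v t = 0)
    (h : SignalEq v 0) : v = 0 := by
  refine (hv.ae_eq_iff_eq volume continuous_zero).1 ?_
  filter_upwards [(ae_restrict_iff' measurableSet_Ici).1 h] with t ht
  by_cases hab : t ∈ Icc a b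
  · exact ht (ha.le.trans hab.1)
  · exact hs t hab

lemma IsPiecewiseContinuous.add_smul (hu : IsPiecewiseContinuous u)
    (hv : IsPiecewiseContinuous v) (c : ℝ) : IsPiecewiseContinuous (u + c • v) := by
  refine ⟨fun T => ((hu.1 T).union (hv.1 T)).subset ?_, fun t ht => ?_, fun t ht => ?_⟩
  · rintro t ⟨ht, h⟩
    by_contra! hc
    simp only [mem_union, mem_ofPred_eq, not_or, not_and_not_right] at hc
    exact h ((hc.1 ht).add ((hc.2 ht).const_smul c))
  · obtain ⟨l, hl⟩ := hu.2.1 t ht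
    obtain ⟨l', hl'⟩ := hv.2.1 t ht
    exact ⟨l + c • l', hl.add (hl'.const_smul c)⟩
  · obtain ⟨l, hl⟩ := hu.2.2 t ht
    obtain ⟨l', hl'⟩ := hv.2.2 t ht
    exact ⟨l + c • l', hl.add (hl'.const_smul c)⟩

lemma isPiecewiseContinuous_of_continuous (hv : Continuous v) : IsPiecewiseContinuous v :=
  ⟨fun _ => finite_empty.subset fun _ ht => ht.2 hv.continuousWithinAt,
    fun t _ => ⟨v t, hv.continuousWithinAt⟩, fun t _ => ⟨v t, hv.continuousWithinAt⟩⟩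

lemma IsPiecewiseContinuous.aestronglyMeasurable (hu : IsPiecewiseContinuous u) :
    AEStronglyMeasurable u (volume.restrict (Ici 0)) := by
  let D := {t | t ∈ Ici (0 : ℝ) ∧ ¬ ContinuousWithinAt u (Ici 0) t}
  have hD : D.Countable := by
    refine (countable_iUnion fun N : ℕ => (hu.1 N).countable).mono fun t ht => ?_
    obtain ⟨N, hN⟩ := exists_nat_ge t
    exact mem_iUnion.2 ⟨N, ⟨ht.1, hN⟩, ht.2⟩
  have hcont : ContinuousOn u (Ici 0 \ D) := fun t ht => by
    have : ContinuousWithinAt u (Ici 0) t := by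
      by_contra h
      exact ht.2 ⟨ht.1, h⟩
    exact this.mono sdiff_subset
  rw [← Measure.restrict_congr_set (sdiff_null_ae_eq_self (hD.measure_zero volume))]
  exact hcont.aestronglyMeasurable (measurableSet_Ici.diff hD.measurableSet)

lemma IsPiecewiseContinuous.exists_Icc_continuousAt (hu : IsPiecewiseContinuous u) :
    ∃ a b : ℝ, 0 < a ∧ a < b ∧ ∀ t ∈ Icc a b, ContinuousAt u t := by
  obtain ⟨t, ht, htD⟩ := (Ioo_infinite (zero_lt_one (α := ℝ))).exists_notMem_finite (hu.1 1)
  obtain ⟨b, hb, hsub⟩ := mem_nhdsGE_iff_exists_Icc_subset.1 (mem_nhdsWithin_of_mem_nhds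
    ((isOpen_Ioo.sdiff (hu.1 1).isClosed).mem_nhds ⟨ht, htD⟩))
  refine ⟨t, b, ht.1, hb, fun s hs => ?_⟩
  obtain ⟨hs01, hsD⟩ := hsub hs
  by_contra h
  exact hsD ⟨Ioo_subset_Icc_self hs01, fun hc => h (hc.continuousAt (Ici_mem_nhds hs01.1))⟩

lemma locallyIntegrable_of_mem_inputSignals (hu : u ∈ InputSignals k) : LocallyIntegrable u := by
  obtain ⟨hu0, hpc, M, a, hb⟩ := hu
  have hind : (Ici 0).indicator u = u :=
    indicator_eq_self.2 fun t ht => not_lt.1 fun h => ht (hu0 t h)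
  have hmeas : AEStronglyMeasurable u := by
    rw [← hind]
    exact (aestronglyMeasurable_indicator_iff measurableSet_Ici).2 hpc.aestronglyMeasurable
  have hexp : Continuous fun t => |M| * Real.exp (a * t) := by fun_prop
  refine hexp.locallyIntegrable.mono hmeas (Eventually.of_forall fun t => ?_)
  rcases lt_or_ge t 0 with ht | ht
  · rw [hu0 t ht, norm_zero]
    exact norm_nonneg _
  · refine (hb t ht).trans ?_
    rw [norm_mul, norm_abs_eq_norm]
    exact mul_le_mul (le_abs_self M) (le_abs_self _) (Real.exp_pos _).le (abs_nonneg M)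

lemma add_smul_mem_inputSignals (hu : u ∈ InputSignals k) (hv : v ∈ InputSignals k) (c : ℝ) :
    u + c • v ∈ InputSignals k := by
  obtain ⟨hu0, hupc, M, r, hM⟩ := hu
  obtain ⟨hv0, hvpc, N, s, hN⟩ := hv
  refine ⟨fun t ht => by simp [hu0 t ht, hv0 t ht], hupc.add_smul hvpc c,
    |M| + |c| * |N|, max r s, fun t ht => ?_⟩
  have hbound {K q : ℝ} (hq : q ≤ max r s) :
      K * Real.exp (q * t) ≤ |K| * Real.exp (max r s * t) := by
    gcongr
    exact le_abs_self K
  calc ‖u t + c • v t‖ ≤ ‖u t‖ + |c| * ‖v t‖ := by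
        simpa [norm_smul] using norm_add_le (u t) (c • v t)
    _ ≤ |M| * Real.exp (max r s * t) + |c| * (|N| * Real.exp (max r s * t)) := by
        gcongr
        · exact (hM t ht).trans (hbound (le_max_left r s))
        · exact (hN t ht).trans (hbound (le_max_right r s))
    _ = (|M| + |c| * |N|) * Real.exp (max r s * t) := by ring

lemma mem_inputSignals_of_continuous (hv : Continuous v) (ha : 0 < a)
    (hs : ∀ t ∉ Icc a b, v t = 0) : v ∈ InputSignals k := by
  obtain ⟨K, hK⟩ :=
    hv.bounded_above_of_compact_support (HasCompactSupport.intro isCompact_Icc hs)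
  exact ⟨fun t ht => hs t fun h => (ht.trans ha).not_ge h.1,
    isPiecewiseContinuous_of_continuous hv, K, 0, fun t _ => by simpa using hK t⟩

lemma eventually_forall_add_smul_mem {O : Set (Fin k → ℝ)} (hO : IsOpen O) (ha : 0 < a)
    (huc : ∀ t ∈ Icc a b, ContinuousAt u t) (huO : ∀ t, 0 ≤ t → u t ∈ O) (hv : Continuous v)
    (hs : ∀ t ∉ Icc a b, v t = 0) : ∀ᶠ c : ℝ in 𝓝 0, ∀ t, 0 ≤ t → (u + c • v) t ∈ O := by
  have hloc : ∀ᶠ c : ℝ in 𝓝 0, ∀ t ∈ Icc a b, u t + c • v t ∈ O := by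
    refine isCompact_Icc.eventually_forall_of_forall_eventually fun t ht => ?_
    have hcont : ContinuousAt (fun q : ℝ × ℝ => u q.2 + q.1 • v q.2) (0, t) :=
      (ContinuousAt.comp (f := Prod.snd) (huc t ht) continuousAt_snd).add
        (continuousAt_fst.smul (hv.comp continuous_snd).continuousAt)
    exact hcont (hO.mem_nhds (by simpa using huO t (ha.le.trans ht.1)))
  filter_upwards [hloc] with c hc t ht
  by_cases hab : t ∈ Icc a b
  · exact hc t hab
  · simpa [hs t hab] using huO t ht

end Signals

section MulVec

variable {k l r : ℕ} (R : Matrix (Fin l) (Fin k) ℝ) (Q : Matrix (Fin l) (Fin r) ℝ)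
  {f : ℝ → Fin k → ℝ} {g : ℝ → Fin r → ℝ} {a b : ℝ}

lemma intervalIntegrable_mulVec (hf : IntervalIntegrable f volume a b) :
    IntervalIntegrable (fun s => R *ᵥ f s) volume a b :=
  ⟨R.mulVecLin.toContinuousLinearMap.integrable_comp hf.1,
    R.mulVecLin.toContinuousLinearMap.integrable_comp hf.2⟩

lemma integral_mulVec_add_mulVec (hf : IntervalIntegrable f volume a b)
    (hg : IntervalIntegrable g volume a b) :
    ∫ s in a..b, (R *ᵥ f s + Q *ᵥ g s) = R *ᵥ (∫ s in a..b, f s) + Q *ᵥ ∫ s in a..b, g s :=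
  (intervalIntegral.integral_add (intervalIntegrable_mulVec R hf)
      (intervalIntegrable_mulVec Q hg)).trans
    (congrArg₂ (· + ·) (R.mulVecLin.toContinuousLinearMap.intervalIntegral_comp_comm hf)
      (Q.mulVecLin.toContinuousLinearMap.intervalIntegral_comp_comm hg))

lemma integral_pi_apply (hf : IntervalIntegrable f volume a b) (i : Fin k) :
    (∫ s in a..b, f s) i = ∫ s in a..b, f s i :=
  ((ContinuousLinearMap.proj (R := ℝ) (φ := fun _ : Fin k => ℝ) i).intervalIntegral_comp_comm
    hf).symm

end MulVec

namespace LTISystem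

variable {n m p : ℕ} {S : LTISystem n m p}

section Triples

lemma IsStateResponse.add_smul {x₁ x₂ : ℝ → Fin n → ℝ} {u₁ u₂ : ℝ → Fin m → ℝ}
    {ξ₁ ξ₂ : Fin n → ℝ} (h₁ : S.IsStateResponse ξ₁ u₁ x₁) (h₂ : S.IsStateResponse ξ₂ u₂ x₂)
    (hu₁ : LocallyIntegrable u₁) (hu₂ : LocallyIntegrable u₂) (hx₁ : ContinuousOn x₁ (Ici 0))
    (hx₂ : ContinuousOn x₂ (Ici 0)) (c : ℝ) :
    S.IsStateResponse (ξ₁ + c • ξ₂) (u₁ + c • u₂) (x₁ + c • x₂) := by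
  intro t ht
  have hint {u : ℝ → Fin m → ℝ} {x : ℝ → Fin n → ℝ} (hu : LocallyIntegrable u)
      (hx : ContinuousOn x (Ici 0)) :
      IntervalIntegrable (fun s => S.A *ᵥ x s + S.B *ᵥ u s) volume 0 t :=
    (intervalIntegrable_mulVec _
        ((hx.mono Icc_subset_Ici_self).intervalIntegrable_of_Icc ht)).add
      (intervalIntegrable_mulVec _ (intervalIntegrable_of_locallyIntegrable hu 0 t))
  have hsplit (s : ℝ) : S.A *ᵥ (x₁ + c • x₂) s + S.B *ᵥ (u₁ + c • u₂) s =
      (S.A *ᵥ x₁ s + S.B *ᵥ u₁ s) + c • (S.A *ᵥ x₂ s + S.B *ᵥ u₂ s) := by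
    simp only [Pi.add_apply, Pi.smul_apply, Matrix.mulVec_add, Matrix.mulVec_smul]
    module
  have hsum := intervalIntegral.integral_add (hint hu₁ hx₁) ((hint hu₂ hx₂).smul c)
  simp only [Pi.smul_apply, intervalIntegral.integral_smul] at hsum
  simp only [hsplit]
  rw [hsum, Pi.add_apply, Pi.smul_apply, h₁ t ht, h₂ t ht]
  module

lemma add_smul_mem_unconstrainedTriples {ξ₁ ξ₂ : Fin n → ℝ} {u₁ u₂ : ℝ → Fin m → ℝ}
    {x₁ x₂ : ℝ → Fin n → ℝ} {y₁ y₂ : ℝ → Fin p → ℝ}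
    (h₁ : (u₁, x₁, y₁) ∈ S.unconstrainedTriples ξ₁)
    (h₂ : (u₂, x₂, y₂) ∈ S.unconstrainedTriples ξ₂) (c : ℝ) :
    (u₁ + c • u₂, x₁ + c • x₂, y₁ + c • y₂) ∈ S.unconstrainedTriples (ξ₁ + c • ξ₂) := by
  obtain ⟨⟨hu₁, hx₁, hy₁⟩, hr₁, ho₁⟩ := h₁
  obtain ⟨⟨hu₂, hx₂, hy₂⟩, hr₂, ho₂⟩ := h₂
  refine ⟨⟨add_smul_mem_inputSignals hu₁ hu₂ c,
    ContinuousOn.add hx₁ (ContinuousOn.const_smul hx₂ c), hy₁.add_smul hy₂ c⟩,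
    hr₁.add_smul hr₂ (locallyIntegrable_of_mem_inputSignals hu₁)
      (locallyIntegrable_of_mem_inputSignals hu₂) hx₁ hx₂ c, ?_⟩
  filter_upwards [ho₁, ho₂] with t ht₁ ht₂
  simp only [Pi.add_apply, Pi.smul_apply, Matrix.mulVec_add, Matrix.mulVec_smul] at ht₁ ht₂ ⊢
  rw [ht₁, ht₂]
  module

lemma mem_unconstrainedTriples_of_signalEq {ξ : Fin n → ℝ} {u : ℝ → Fin m → ℝ}
    {x : ℝ → Fin n → ℝ} {y y' : ℝ → Fin p → ℝ} (h : (u, x, y) ∈ S.unconstrainedTriples ξ)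
    (hy' : y' ∈ OutputSignals p) (hyy' : SignalEq y y') :
    (u, x, y') ∈ S.unconstrainedTriples ξ :=
  ⟨⟨h.1.1, h.1.2.1, hy'⟩, h.2.1, hyy'.symm.trans h.2.2⟩

lemma irPairs_subset_admissiblePairs (U : Set (Fin m → ℝ)) (X : Set (Fin n → ℝ)) :
    S.irPairs U X ⊆ S.admissiblePairs U X := by
  rintro ⟨ξ, y⟩ ⟨hmem, ⟨u, y'⟩, ⟨x, htriple, hu, hx, -⟩, -, -, -, hy, -⟩
  exact ⟨hmem, u, x, mem_unconstrainedTriples_of_signalEq htriple hmem.2 hy, hu, hx, hmem.2⟩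

lemma IsUnconstrainedIR.exists_mem_unconstrainedTriples_zero (hS : S.IsUnconstrainedIR) :
    ∃ u x, (u, x, 0) ∈ S.unconstrainedTriples 0 ∧ ¬ SignalEq u 0 := by
  obtain ⟨⟨ξ, y⟩, -, ⟨u₁, y₁⟩, ⟨x₁, h₁, -⟩, ⟨u₂, y₂⟩, ⟨x₂, h₂, -⟩, hne, hy₁, hy₂⟩ := hS
  refine ⟨u₁ + (-1 : ℝ) • u₂, x₁ + (-1 : ℝ) • x₂, ?_, fun h => hne ?_⟩
  · have hdiff := add_smul_mem_unconstrainedTriples h₁ h₂ (-1)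
    rw [neg_one_smul ℝ ξ, add_neg_cancel] at hdiff
    refine mem_unconstrainedTriples_of_signalEq hdiff
      (isPiecewiseContinuous_of_continuous continuous_zero) ?_
    filter_upwards [hy₁.trans hy₂.symm] with t ht
    simp [ht]
  · filter_upwards [h] with t ht
    simpa [add_neg_eq_zero] using ht

lemma IsStateResponse.congr_state {ξ : Fin n → ℝ} {u : ℝ → Fin m → ℝ} {x x' : ℝ → Fin n → ℝ}
    (h : S.IsStateResponse ξ u x) (hxx' : EqOn x x' (Ici 0)) : S.IsStateResponse ξ u x' := by
  intro t ht
  rw [← hxx' ht, h t ht]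
  congr 1
  refine intervalIntegral.integral_congr fun s hs => ?_
  rw [uIcc_of_le ht] at hs
  simp only [hxx' hs.1]

lemma exists_causal_state {u : ℝ → Fin m → ℝ} {x : ℝ → Fin n → ℝ} {y : ℝ → Fin p → ℝ}
    (h : (u, x, y) ∈ S.unconstrainedTriples 0) :
    ∃ x', Continuous x' ∧ (∀ t ≤ 0, x' t = 0) ∧ (u, x', y) ∈ S.unconstrainedTriples 0 := by
  obtain ⟨⟨hu, hx, hy⟩, hresp, hout⟩ := h
  simp only at hu hx hy hresp hout
  have hx' : Continuous fun t => x (max t 0) :=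
    ContinuousOn.comp_continuous hx (by fun_prop) fun t => le_max_right t 0
  have hxx' : EqOn x (fun t => x (max t 0)) (Ici 0) := fun t ht =>
    congrArg x (max_eq_left ht).symm
  refine ⟨fun t => x (max t 0), hx', fun t ht => ?_, ⟨hu, hx'.continuousOn, hy⟩,
    hresp.congr_state hxx', ?_⟩
  · simp only [max_eq_right ht, hresp 0 le_rfl, intervalIntegral.integral_same, add_zero]
  · filter_upwards [hout, self_mem_ae_restrict measurableSet_Ici] with t ht ht0
    rw [ht, hxx' ht0]

lemma IsStateResponse.integral {u : ℝ → Fin m → ℝ} {x : ℝ → Fin n → ℝ}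
    (h : S.IsStateResponse 0 u x) (hu : LocallyIntegrable u) (hx : Continuous x) :
    S.IsStateResponse 0 (fun t => ∫ s in (0 : ℝ)..t, u s) (fun t => ∫ s in (0 : ℝ)..t, x s) := by
  intro t ht
  rw [zero_add]
  refine intervalIntegral.integral_congr fun s hs => ?_
  rw [uIcc_of_le ht] at hs
  rw [h s hs.1, zero_add]
  exact integral_mulVec_add_mulVec S.A S.B (hx.intervalIntegrable 0 s)
    (intervalIntegrable_of_locallyIntegrable hu 0 s)

end Triples

section Pencil

/-- The system pencil in the integration operator `X`: it annihilates the causal trajectories that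
start at `0` and have zero output. It is `[s - A, -B; C, D]` at `s = 1 / X`, with the first block
row multiplied by `X`. -/
noncomputable def pencil (S : LTISystem n m p) :
    Matrix (Fin n ⊕ Fin p) (Fin n ⊕ Fin m) ℝ[X] :=
  Matrix.fromBlocks (1 - (Polynomial.X : ℝ[X]) • S.A.map Polynomial.C)
    (-((Polynomial.X : ℝ[X]) • S.B.map Polynomial.C)) (S.C.map Polynomial.C)
    (S.D.map Polynomial.C)

lemma sum_pencil_inl_smul (w : Fin n ⊕ Fin m → causalFunctions) (i : Fin n) :
    ∑ j, S.pencil (.inl i) j • w j =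
      w (.inl i) - integration (∑ j, S.A i j • w (.inl j) + ∑ j, S.B i j • w (.inr j)) := by
  simp only [pencil, Fintype.sum_sum_type, Matrix.fromBlocks_apply₁₁, Matrix.fromBlocks_apply₁₂,
    Matrix.sub_apply, Matrix.neg_apply, Matrix.smul_apply, Matrix.map_apply, smul_eq_mul, sub_smul,
    neg_smul, mul_smul, C_smul_eq_smul, X_smul_eq_integration, Finset.sum_sub_distrib,
    Finset.sum_neg_distrib, Matrix.one_apply, ite_smul, one_smul, zero_smul, Finset.sum_ite_eq,
    Finset.mem_univ, if_true, map_add, map_sum]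
  abel

lemma sum_pencil_inr_smul (w : Fin n ⊕ Fin m → causalFunctions) (i : Fin p) :
    ∑ j, S.pencil (.inr i) j • w j =
      ∑ j, S.C i j • w (.inl j) + ∑ j, S.D i j • w (.inr j) := by
  simp only [pencil, Fintype.sum_sum_type, Matrix.fromBlocks_apply₂₁, Matrix.fromBlocks_apply₂₂,
    Matrix.map_apply, C_smul_eq_smul]

lemma sum_smul_add_sum_smul_apply {l : ℕ} (R : Matrix (Fin l) (Fin n) ℝ)
    (Q : Matrix (Fin l) (Fin m) ℝ) (z : Fin n → causalFunctions) (v : Fin m → causalFunctions)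
    (i : Fin l) (t : ℝ) :
    (∑ j, R i j • z j + ∑ j, Q i j • v j).1 t =
      (R *ᵥ (fun j => (z j).1 t) + Q *ᵥ fun j => (v j).1 t) i := by
  simp [Matrix.mulVec, dotProduct]

lemma sum_pencil_smul_eq_zero_iff {w : Fin n ⊕ Fin m → causalFunctions} :
    (∀ r, ∑ j, S.pencil r j • w j = 0) ↔
      S.IsStateResponse 0 (fun t i => (w (.inr i)).1 t) (fun t i => (w (.inl i)).1 t) ∧
      ∀ t, 0 ≤ t → S.C *ᵥ (fun i => (w (.inl i)).1 t) + S.D *ᵥ (fun i => (w (.inr i)).1 t) = 0 := by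
  have hint (t : ℝ) : IntervalIntegrable (fun s => S.A *ᵥ (fun i => (w (.inl i)).1 s) +
      S.B *ᵥ (fun i => (w (.inr i)).1 s)) volume 0 t :=
    (intervalIntegrable_mulVec _
      ((continuous_pi fun i => (w (.inl i)).2.1).intervalIntegrable 0 t)).add
      (intervalIntegrable_mulVec _
        ((continuous_pi fun i => (w (.inr i)).2.1).intervalIntegrable 0 t))
  have hstate (i : Fin n) : ∑ j, S.pencil (.inl i) j • w j = 0 ↔ ∀ t, 0 ≤ t →
      (w (.inl i)).1 t = (∫ s in (0 : ℝ)..t, (S.A *ᵥ (fun i => (w (.inl i)).1 s) +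
        S.B *ᵥ (fun i => (w (.inr i)).1 s))) i := by
    rw [sum_pencil_inl_smul, sub_eq_zero]
    simp only [integral_pi_apply (hint _), ← sum_smul_add_sum_smul_apply, ← integration_apply]
    exact ⟨fun h t _ => congrArg (fun f => f.1 t) h, causalFunctions_ext⟩
  have houtput (i : Fin p) : ∑ j, S.pencil (.inr i) j • w j = 0 ↔ ∀ t, 0 ≤ t →
      (S.C *ᵥ (fun i => (w (.inl i)).1 t) + S.D *ᵥ fun i => (w (.inr i)).1 t) i = 0 := by
    rw [sum_pencil_inr_smul]
    simp only [← sum_smul_add_sum_smul_apply]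
    exact ⟨fun h t _ => congrArg (fun f => f.1 t) h, fun h => causalFunctions_ext h⟩
  simp only [Sum.forall, hstate, houtput, IsStateResponse, zero_add, funext_iff]
  exact and_congr ⟨fun h t ht i => h i t ht, fun h i t ht => h t ht i⟩
    ⟨fun h t ht i => h i t ht, fun h i t ht => h t ht i⟩

/- Inputs need not be continuous, so the relation is between the primitives of the signals. -/
lemma exists_sum_pencil_smul_eq_zero {u : ℝ → Fin m → ℝ} {x : ℝ → Fin n → ℝ}
    (h : (u, x, 0) ∈ S.unconstrainedTriples 0) (hu_ne : ¬ SignalEq u 0) :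
    ∃ w : Fin n ⊕ Fin m → causalFunctions, (∃ i, w (.inr i) ≠ 0) ∧
      ∀ r, ∑ j, S.pencil r j • w j = 0 := by
  obtain ⟨x, hx, hx0, ⟨⟨hu_mem, -, -⟩, hresp, hout⟩⟩ := exists_causal_state h
  simp only at hu_mem hresp hout
  have hu := locallyIntegrable_of_mem_inputSignals hu_mem
  have hu_apply (i : Fin m) : LocallyIntegrable fun t => u t i := fun t =>
    let ⟨s, hs, hint⟩ := hu t
    ⟨s, hs, hint.eval i⟩
  let w : Fin n ⊕ Fin m → causalFunctions := Sum.elim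
    (fun i => integration ⟨fun t => x t i, (continuous_apply i).comp hx,
      fun t ht => congrFun (hx0 t ht) i⟩)
    (fun i => primitive (fun t => u t i) (hu_apply i) fun t ht => congrFun (hu_mem.1 t ht) i)
  have hwx : (fun t i => (w (.inl i)).1 t) = fun t => ∫ s in (0 : ℝ)..t, x s :=
    funext₂ fun t i => (integral_pi_apply (hx.intervalIntegrable 0 t) i).symm
  have hwu : (fun t i => (w (.inr i)).1 t) = fun t => ∫ s in (0 : ℝ)..t, u s :=
    funext₂ fun t i =>
      (integral_pi_apply (intervalIntegrable_of_locallyIntegrable hu 0 t) i).symm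
  refine ⟨w, ?_, sum_pencil_smul_eq_zero_iff.2 ⟨?_, fun t ht => ?_⟩⟩
  · by_contra! hw
    refine hu_ne (ae_restrict_of_ae (ae_eq_zero_of_primitive_eq_zero hu fun t => ?_))
    rw [← congrFun hwu t]
    simp only [hw]
    rfl
  · rw [hwx, hwu]
    exact hresp.integral hu hx
  · rw [congrFun hwx t, congrFun hwu t,
      ← integral_mulVec_add_mulVec S.C S.D (hx.intervalIntegrable 0 t)
        (intervalIntegrable_of_locallyIntegrable hu 0 t)]
    refine intervalIntegral.integral_zero_ae ?_
    filter_upwards [(ae_restrict_iff' measurableSet_Ici).1 hout] with s hs hst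
    rw [uIoc_of_le ht] at hst
    exact (hs hst.1.le).symm

lemma exists_pencil_mulVec_eq_zero_of_isUnconstrainedIR (hS : S.IsUnconstrainedIR) :
    ∃ (P : Fin n → ℝ[X]) (Q : Fin m → ℝ[X]), Q ≠ 0 ∧ S.pencil *ᵥ Sum.elim P Q = 0 := by
  obtain ⟨u, x, h, hu⟩ := hS.exists_mem_unconstrainedTriples_zero
  obtain ⟨w, ⟨i, hi⟩, hw⟩ := exists_sum_pencil_smul_eq_zero h hu
  obtain ⟨q, hq, hker⟩ := exists_mulVec_eq_zero_of_sum_smul_eq_zero hw hi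
  exact ⟨q ∘ .inl, q ∘ .inr, Function.ne_iff.2 ⟨i, hq⟩, by rwa [Sum.elim_comp_inl_inr]⟩

lemma exists_pencil_mulVec_eq_zero_of_rho_pos (hS : 0 < S.rho) :
    ∃ Q : Fin m → ℝ[X], Q ≠ 0 ∧ S.pencil *ᵥ Sum.elim 0 Q = 0 := by
  obtain ⟨⟨d, hB, hD⟩, hd⟩ :=
    @exists_ne _ (Module.nontrivial_of_finrank_pos hS) 0
  obtain ⟨i, hi⟩ := Function.ne_iff.1 (Subtype.coe_ne_coe.2 hd)
  have hmap {l : ℕ} {R : Matrix (Fin l) (Fin m) ℝ} (hR : R *ᵥ d = 0) :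
      R.map Polynomial.C *ᵥ (fun i => Polynomial.C (d i)) = 0 := by
    funext j
    exact (RingHom.map_mulVec Polynomial.C R d j).symm.trans (by simp [hR])
  refine ⟨fun i => Polynomial.C (d i), Function.ne_iff.2 ⟨i, by simpa using hi⟩, ?_⟩
  rw [pencil, Matrix.fromBlocks_mulVec]
  simp [Matrix.neg_mulVec, Matrix.smul_mulVec, hmap hB, hmap hD]

end Pencil

section NullPerturbation

/-- A nonzero continuous input `v` that steers `0` to `0` along `z` with zero output, both `v` and
`z` vanishing outside the time interval `[a, b]`. -/
structure IsNullPerturbation (S : LTISystem n m p) (a b : ℝ) (v : ℝ → Fin m → ℝ)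
    (z : ℝ → Fin n → ℝ) : Prop where
  mem_unconstrainedTriples : (v, z, 0) ∈ S.unconstrainedTriples 0
  continuous_input : Continuous v
  continuous_state : Continuous z
  input_ne_zero : v ≠ 0
  input_eq_zero : ∀ t ∉ Icc a b, v t = 0
  state_eq_zero : ∀ t ∉ Icc a b, z t = 0

lemma exists_isNullPerturbation_of_pencil_mulVec_eq_zero {P : Fin n → ℝ[X]}
    {Q : Fin m → ℝ[X]} (hQ : Q ≠ 0) (hker : S.pencil *ᵥ Sum.elim P Q = 0)
    {a b : ℝ} (ha : 0 < a) (hab : a < b) :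
    ∃ v z, S.IsNullPerturbation a b v z ∧ (P = 0 → z = 0) := by
  obtain ⟨f, hf, hsupp⟩ := exists_smul_eq_zero_of_notMem_Icc (Sum.elim P Q) ha hab
  have hrel (r) : ∑ j, S.pencil r j • Sum.elim P Q j • f = 0 := by
    simp only [smul_smul, ← Finset.sum_smul]
    exact (congrArg (· • f) (congrFun hker r)).trans (zero_smul _ f)
  obtain ⟨hresp, hout⟩ := sum_pencil_smul_eq_zero_iff.1 hrel
  have hv : Continuous fun t i => (Q i • f).1 t := continuous_pi fun i => (Q i • f).2.1
  have hz : Continuous fun t i => (P i • f).1 t := continuous_pi fun i => (P i • f).2.1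
  have hv0 (t) (ht : t ∉ Icc a b) : (fun i => (Q i • f).1 t) = 0 :=
    funext fun i => hsupp (.inr i) t ht
  refine ⟨fun t i => (Q i • f).1 t, fun t i => (P i • f).1 t, ?_, ?_⟩
  · refine ⟨⟨⟨mem_inputSignals_of_continuous hv ha hv0, hz.continuousOn,
      isPiecewiseContinuous_of_continuous continuous_zero⟩, hresp, ?_⟩, hv, hz, fun h => ?_, hv0,
      fun t ht => funext fun i => hsupp (.inl i) t ht⟩
    · exact (ae_restrict_iff' measurableSet_Ici).2
        (Eventually.of_forall fun t ht => (hout t ht).symm)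
    · obtain ⟨i, hi⟩ := Function.ne_iff.1 hQ
      exact smul_ne_zero hi hf (Subtype.ext (funext fun t => congrFun (congrFun h t) i))
  · rintro rfl
    funext t i
    simp

theorem irPairs_eq_admissiblePairs_of_pencil_mulVec_eq_zero {P : Fin n → ℝ[X]}
    {Q : Fin m → ℝ[X]} (hQ : Q ≠ 0) (hker : S.pencil *ᵥ Sum.elim P Q = 0)
    {U : Set (Fin m → ℝ)} {X : Set (Fin n → ℝ)} (hU : IsOpen U) (hX : P = 0 ∨ IsOpen X) :
    S.irPairs U X = S.admissiblePairs U X := by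
  refine (irPairs_subset_admissiblePairs U X).antisymm ?_
  rintro ⟨ξ, y⟩ ⟨hmem, u, x, htriple⟩
  obtain ⟨huncon, ⟨huU, hu⟩, ⟨hxX, hx⟩, hy⟩ := id htriple
  obtain ⟨a, b, ha, hab, huc⟩ := hu.2.1.exists_Icc_continuousAt
  obtain ⟨v, z, hvz, hPz⟩ := exists_isNullPerturbation_of_pencil_mulVec_eq_zero hQ hker ha hab
  have hinput := eventually_forall_add_smul_mem hU ha huc huU hvz.continuous_input
    hvz.input_eq_zero
  have hstate : ∀ᶠ c : ℝ in 𝓝 0, ∀ t, 0 ≤ t → (x + c • z) t ∈ X := by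
    rcases hX with hP | hX
    · simpa [hPz hP] using hxX
    · exact eventually_forall_add_smul_mem hX ha
        (fun t ht => ContinuousOn.continuousAt hx (Ici_mem_nhds (ha.trans_le ht.1)))
        hxX hvz.continuous_state hvz.state_eq_zero
  obtain ⟨c, ⟨hcu, hcx⟩, hc : c ≠ 0⟩ :=
    (((hinput.and hstate).filter_mono nhdsWithin_le_nhds).and
      (self_mem_nhdsWithin (a := (0 : ℝ)) (s := {0}ᶜ))).exists
  have hperturbed : (u + c • v, x + c • z, y) ∈ S.unconstrainedTriples ξ := by
    simpa using add_smul_mem_unconstrainedTriples huncon hvz.mem_unconstrainedTriples c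
  refine ⟨hmem, (u, y), ⟨x, htriple⟩, (u + c • v, y), ⟨x + c • z, hperturbed,
    ⟨hcu, hperturbed.1.1⟩, ⟨hcx, hperturbed.1.2.1⟩, hy⟩, fun h => hvz.input_ne_zero ?_,
    EventuallyEq.rfl, EventuallyEq.rfl⟩
  refine eq_zero_of_signalEq_zero hvz.continuous_input ha hvz.input_eq_zero ?_
  filter_upwards [h] with t ht
  simpa [hc] using ht

end NullPerturbation

end LTISystem

end InputRedundancy

theorem corollary1 {n m p : ℕ} (S : InputRedundancy.LTISystem n m p)
    (U : Set (Fin m → ℝ)) (X : Set (Fin n → ℝ))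
    (hS : S.IsUnconstrainedIR)
    (h : (0 < S.rho ∧ IsOpen U) ∨ (S.rho = 0 ∧ IsOpen U ∧ IsOpen X)) :
    S.irPairs U X = S.admissiblePairs U X ∧
      ((S.admissiblePairs U X).Nonempty → S.IsUniformlyIR U X) := by
  have heq : S.irPairs U X = S.admissiblePairs U X := by
    rcases h with ⟨hρ, hU⟩ | ⟨-, hU, hX⟩
    · obtain ⟨Q, hQ, hker⟩ :=
        InputRedundancy.LTISystem.exists_pencil_mulVec_eq_zero_of_rho_pos hρ
      exact InputRedundancy.LTISystem.irPairs_eq_admissiblePairs_of_pencil_mulVec_eq_zero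
        hQ hker hU (.inl rfl)
    · obtain ⟨P, Q, hQ, hker⟩ :=
        InputRedundancy.LTISystem.exists_pencil_mulVec_eq_zero_of_isUnconstrainedIR hS
      exact InputRedundancy.LTISystem.irPairs_eq_admissiblePairs_of_pencil_mulVec_eq_zero
        hQ hker hU (.inr hX)
  exact ⟨heq, fun hne => ⟨by rwa [← heq] at hne, heq.symm⟩⟩
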